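/- Let $E$ be a real Banach lattice. A sequence $(z_n)$ in $E$ is unbounded order null (uo-null) if for every $y\in E^+$ the sequence $|z_n|\wedge y$ converges to $0$ in order, i.e. there is a net $(d_\beta)$ in $E$ with $d_\beta\downarrow 0$ such that for every $\beta$ one has $|z_n|\wedge y\le d_\beta$ for all sufficiently large $n$. Let $T:E\to E$ be a bounded linear operator which is uo-demi Dunford–Pettis, that is: whenever $(x_n)$ is a weakly null sequence in $E$ such that $(x_n-T(x_n))$ is uo-null, then $\|x_n\|\to 0$. Suppose that the closed subspace $K=\mathrm{Ker}(\mathrm{Id}_E-T)$ is a Riesz space, i.e. in the order induced by $E$ any two elements of $K$ have a supremum and an infimum in $K$ (for instance, $K$ is a Riesz subspace of $E$). Then $K$, regarded as a Banach lattice in its own right, has the positive Schur property: every weakly null sequence of positive elements of $K$ converges to $0$ in norm. Precisely, every sequence of positive elements of $K$ that is weakly null in $K$ is norm null for the norm of $E$; moreover, there is a norm on $K$, equivalent to the norm of $E$ and equal to it if $K$ is a Riesz subspace of $E$, under which $K$ with its induced order is a Banach lattice, and this Banach lattice has the positive Schur property. -/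

import Mathlib

open Filter Topology

universe u

/-- `(x n)` converges weakly to `0` in the normed space `X`. -/
def WeaklyNull {X : Type*} [NormedAddCommGroup X] [NormedSpace ℝ X] (x : ℕ → X) : Prop :=
  ∀ f : StrongDual ℝ X, Tendsto (fun n => f (x n)) atTop (𝓝 0)

/-- Order convergence of a net `x` to `a` in a vector lattice: some net `y_β ↓ 0` (with its own
index set) satisfies: for every `β`, eventually `|x i - a| ≤ y_β`. Only the range `D` of
`(y_β)` matters, and the ranges of nets decreasing to `0` are the nonempty, downward directed
sets with infimum `0`. -/
def OrderConverges {E ι : Type*} [AddCommGroup E] [Lattice E] [Preorder ι]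
    (x : ι → E) (a : E) : Prop :=
  ∃ D : Set E, D.Nonempty ∧ DirectedOn (· ≥ ·) D ∧ IsGLB D 0 ∧
    ∀ d ∈ D, ∀ᶠ i in atTop, |x i - a| ≤ d

/-- Unbounded order convergence: `|x i - a| ⊓ y` order converges to `0` for every `y ≥ 0`. -/
def UoConverges {E ι : Type*} [AddCommGroup E] [Lattice E] [Preorder ι]
    (x : ι → E) (a : E) : Prop :=
  ∀ y : E, 0 ≤ y → OrderConverges (fun i => |x i - a| ⊓ y) 0

/-- Unbounded order demi Dunford–Pettis operators. -/
def UoDemiDunfordPettis {E : Type*} [NormedAddCommGroup E] [NormedSpace ℝ E] [Lattice E]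
    (T : E →L[ℝ] E) : Prop :=
  ∀ x : ℕ → E, WeaklyNull x → UoConverges (fun n => x n - T (x n)) 0 →
    Tendsto (fun n => ‖x n‖) atTop (𝓝 0)

/-- An ordered real vector space is a Riesz space if any two elements have a supremum and an
infimum. -/
def IsRieszSpace (V : Type*) [AddCommGroup V] [Module ℝ V] [PartialOrder V]
    [IsOrderedAddMonoid V] [IsOrderedModule ℝ V] : Prop :=
  ∀ x y : V, (∃ z, IsLUB {x, y} z) ∧ (∃ z, IsGLB {x, y} z)

/-- A linear subspace closed under the lattice operations of the ambient space. -/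
def IsRieszSubspace {E : Type*} [AddCommGroup E] [Module ℝ E] [Lattice E]
    (K : Submodule ℝ E) : Prop :=
  ∀ x ∈ K, ∀ y ∈ K, x ⊔ y ∈ K ∧ x ⊓ y ∈ K

/-- Every weakly null sequence with positive terms is norm null. -/
def PositiveSchurProperty (X : Type*) [NormedAddCommGroup X] [NormedSpace ℝ X]
    [PartialOrder X] : Prop :=
  ∀ x : ℕ → X, (∀ n, 0 ≤ x n) → WeaklyNull x → Tendsto (fun n => ‖x n‖) atTop (𝓝 0)

/-- The fixed space `Ker (Id - T)`, with the linear structure, norm and order of `E`. -/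
abbrev fixedSpace {E : Type*} [NormedAddCommGroup E] [NormedSpace ℝ E] (T : E →L[ℝ] E) :
    Submodule ℝ E :=
  LinearMap.ker ((ContinuousLinearMap.id ℝ E - T : E →L[ℝ] E) : E →ₗ[ℝ] E)

/-- A subspace of an ordered vector space is an ordered vector space in the induced order. -/
instance submoduleIsOrderedModule {E : Type*} [AddCommGroup E] [Module ℝ E] [PartialOrder E]
    [IsOrderedAddMonoid E] [IsOrderedModule ℝ E] (K : Submodule ℝ E) : IsOrderedModule ℝ K where
  smul_le_smul_of_nonneg_left a ha x y h := by
    have h' : (x : E) ≤ y := h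
    change a • (x : E) ≤ a • (y : E)
    exact smul_le_smul_of_nonneg_left h' ha
  smul_le_smul_of_nonneg_right x hx a b h := by
    have hx' : (0 : E) ≤ x := hx
    change a • (x : E) ≤ b • (x : E)
    exact smul_le_smul_of_nonneg_right h hx'

/-! On `fixedSpace T` the sequence `x n - T (x n)` is identically zero, so the hypothesis on `T`
makes every weakly null sequence there norm null. The remaining work is the Banach lattice norm. The
modulus of `K` may be larger than that of `E`, so `K` is renormed by the `E`-norm of its own
modulus. This norm is solid and dominates the original one. It is complete because tails of a series
are controlled by tails of the series of moduli (`exists_banachLattice_norm`). The open mapping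
theorem then gives equivalence, along which the Schur property transfers. -/

/-- A continuous linear map sends weakly null sequences to weakly null sequences. -/
theorem WeaklyNull.map {X Y : Type*} [NormedAddCommGroup X] [NormedSpace ℝ X]
    [NormedAddCommGroup Y] [NormedSpace ℝ Y] {x : ℕ → X} (hx : WeaklyNull x) (f : X →L[ℝ] Y) :
    WeaklyNull (fun n => f (x n)) :=
  fun g => hx (g.comp f)

/-- The zero sequence is unbounded order null. -/
theorem uoConverges_zero {E ι : Type*} [AddCommGroup E] [Lattice E] [IsOrderedAddMonoid E]
    [Preorder ι] : UoConverges (fun _ : ι => (0 : E)) 0 := by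
  intro y hy
  refine ⟨{0}, Set.singleton_nonempty 0, ?_, isGLB_singleton, ?_⟩
  · rintro a rfl b rfl
    exact ⟨_, rfl, le_rfl, le_rfl⟩
  · rintro d rfl
    exact Eventually.of_forall fun i => by simp [hy]

/-- Weakly null sequences fixed by a uo-demi Dunford–Pettis operator are norm null. -/
theorem UoDemiDunfordPettis.tendsto_norm_of_weaklyNull {E : Type*} [NormedAddCommGroup E]
    [NormedSpace ℝ E] [Lattice E] [IsOrderedAddMonoid E] {T : E →L[ℝ] E}
    (hT : UoDemiDunfordPettis T) {x : ℕ → fixedSpace T} (hx : WeaklyNull x) :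
    Tendsto (fun n => ‖x n‖) atTop (𝓝 0) := by
  refine hT (fun n => (x n : E)) (hx.map (fixedSpace T).subtypeL) ?_
  have h : (fun n => (x n : E) - T (x n)) = fun _ => 0 := by
    funext n
    exact LinearMap.mem_ker.1 (x n).2
  rw [h]
  exact uoConverges_zero

/-- The positive Schur property passes through order preserving isomorphisms. -/
theorem PositiveSchurProperty.of_equiv {X Y : Type*} [NormedAddCommGroup X] [NormedSpace ℝ X]
    [PartialOrder X] [NormedAddCommGroup Y] [NormedSpace ℝ Y] [PartialOrder Y]
    (hY : PositiveSchurProperty Y) (e : X ≃L[ℝ] Y) (he : ∀ x y : X, e x ≤ e y ↔ x ≤ y) :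
    PositiveSchurProperty X := by
  intro x hx hw
  have h0 : Tendsto (fun n => ‖e (x n)‖) atTop (𝓝 0) :=
    hY _ (fun n => by simpa using (he 0 (x n)).2 (hx n)) (hw.map (e : X →L[ℝ] Y))
  have h1 := (e.symm.continuous.tendsto 0).comp (tendsto_zero_iff_norm_tendsto_zero.2 h0)
  exact tendsto_zero_iff_norm_tendsto_zero.1 (by simpa [Function.comp_def] using h1)

/-- The lattice structure of a Riesz space. -/
noncomputable abbrev IsRieszSpace.toLattice {V : Type*} [AddCommGroup V] [Module ℝ V]
    [PartialOrder V] [IsOrderedAddMonoid V] [IsOrderedModule ℝ V] (h : IsRieszSpace V) :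
    Lattice V :=
  { (inferInstance : PartialOrder V) with
    sup := fun x y => (h x y).1.choose
    inf := fun x y => (h x y).2.choose
    le_sup_left := fun x y => (h x y).1.choose_spec.1 (by simp)
    le_sup_right := fun x y => (h x y).1.choose_spec.1 (by simp)
    sup_le := fun x y z hx hy => (h x y).1.choose_spec.2 (by simp [hx, hy])
    inf_le_left := fun x y => (h x y).2.choose_spec.1 (by simp)
    inf_le_right := fun x y => (h x y).2.choose_spec.1 (by simp)
    le_inf := fun x y z hx hy => (h y z).2.choose_spec.2 (by simp [hx, hy]) }

theorem norm_le_norm_of_nonneg_of_le {E : Type*} [NormedAddCommGroup E] [Lattice E]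
    [IsOrderedAddMonoid E] [HasSolidNorm E] {x y : E} (hx : 0 ≤ x) (h : x ≤ y) : ‖x‖ ≤ ‖y‖ :=
  norm_le_norm_of_abs_le_abs (by rwa [abs_of_nonneg hx, abs_of_nonneg (hx.trans h)])

section LatticeNorm

variable {E V : Type*} [NormedAddCommGroup E] [NormedSpace ℝ E] [Lattice E] [HasSolidNorm E]
  [AddCommGroup V] [Module ℝ V] [Lattice V]

/-- Although `j` need not preserve moduli, `j |x|` is an upper bound of `± j x`, hence of `|j x|`.
-/
theorem norm_map_le_norm_map_abs {j : V →ₗ[ℝ] E} (hj : ∀ x y, j x ≤ j y ↔ x ≤ y) (x : V) :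
    ‖j x‖ ≤ ‖j |x|‖ := by
  refine norm_le_norm_of_abs_le_abs (le_trans ?_ (le_abs_self _))
  refine abs_le'.2 ⟨(hj _ _).2 (le_abs_self x), ?_⟩
  rw [← map_neg]
  exact (hj _ _).2 (neg_le_abs x)

variable [IsOrderedAddMonoid E] [IsOrderedAddMonoid V]

theorem norm_map_abs_le {j : V →ₗ[ℝ] E} (hj : ∀ x y, j x ≤ j y ↔ x ≤ y) {x y : V}
    (h : |x| ≤ y) : ‖j |x|‖ ≤ ‖j y‖ :=
  norm_le_norm_of_nonneg_of_le (by simpa using (hj 0 |x|).2 (abs_nonneg x)) ((hj _ _).2 h)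

/-- The lattice norm `x ↦ ‖j |x|‖` on a vector lattice order embedded by `j` in a normed
lattice. -/
noncomputable def latticeNorm (j : V →ₗ[ℝ] E) (hj : ∀ x y, j x ≤ j y ↔ x ≤ y) :
    AddGroupNorm V where
  toFun x := ‖j |x|‖
  map_zero' := by simp
  add_le' x y := by
    refine (norm_map_abs_le hj (abs_add_le x y)).trans ?_
    rw [map_add]
    exact norm_add_le _ _
  neg' x := by rw [abs_neg]
  eq_zero_of_map_eq_zero' x hx := by
    have h : j x = j 0 := by
      rw [map_zero]
      exact norm_le_zero_iff.1 ((norm_map_le_norm_map_abs hj x).trans hx.le)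
    exact le_antisymm ((hj _ _).1 h.le) ((hj _ _).1 h.ge)

end LatticeNorm

theorem abs_smul_of_isOrderedModule {V : Type*} [AddCommGroup V] [Module ℝ V] [Lattice V]
    [IsOrderedModule ℝ V] (c : ℝ) (x : V) : |c • x| = |c| • |x| := by
  have key : ∀ (c : ℝ) (x : V), 0 < c → |c • x| = c • |x| := by
    have le : ∀ (c : ℝ) (x : V), 0 < c → |c • x| ≤ c • |x| := fun c x hc => by
      refine abs_le'.2 ⟨smul_le_smul_of_nonneg_left (le_abs_self x) hc.le, ?_⟩
      rw [← smul_neg]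
      exact smul_le_smul_of_nonneg_left (neg_le_abs x) hc.le
    intro c x hc
    refine le_antisymm (le c x hc) ?_
    -- The reverse inequality is `le` for the scalar `c⁻¹` and the vector `c • x`, multiplied by
    -- `c`.
    have h := smul_le_smul_of_nonneg_left (le c⁻¹ (c • x) (inv_pos.2 hc)) hc.le
    rwa [inv_smul_smul₀ hc.ne', smul_inv_smul₀ hc.ne'] at h
  rcases lt_trichotomy c 0 with hc | rfl | hc
  · rw [abs_of_neg hc, ← key _ _ (neg_pos.2 hc), neg_smul, abs_neg]
  · simp [abs]
  · rw [abs_of_pos hc, key _ _ hc]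

/-- A vector lattice whose order embedding `j` in a Banach lattice has closed range is a Banach
lattice for the norm `x ↦ ‖j |x|‖`, which is equivalent to `x ↦ ‖j x‖`. -/
theorem exists_banachLattice_norm {E : Type*} {V : Type u} [NormedAddCommGroup E]
    [NormedSpace ℝ E] [Lattice E] [IsOrderedAddMonoid E] [IsOrderedModule ℝ E] [HasSolidNorm E]
    [CompleteSpace E] [AddCommGroup V] [Module ℝ V] [Lattice V] [IsOrderedAddMonoid V]
    [IsOrderedModule ℝ V] {K : Submodule ℝ E} (hK : IsClosed (K : Set E)) (j : V ≃ₗ[ℝ] K)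
    (hj : ∀ x y, j x ≤ j y ↔ x ≤ y) :
    ∃ (X : Type u) (_ : NormedAddCommGroup X) (_ : NormedSpace ℝ X) (_ : Lattice X)
      (_ : IsOrderedAddMonoid X) (_ : IsOrderedModule ℝ X) (_ : HasSolidNorm X)
      (_ : CompleteSpace X) (e : X ≃L[ℝ] K),
      (∀ x y : X, e x ≤ e y ↔ x ≤ y) ∧ ∀ x : X, ‖x‖ = ‖(e |x| : E)‖ := by
  let i : V →ₗ[ℝ] E := K.subtype ∘ₗ j.toLinearMap
  have hi : ∀ x y, i x ≤ i y ↔ x ≤ y := hj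
  let N : NormedAddCommGroup V := (latticeNorm i hi).toNormedAddCommGroup
  have hN : ∀ x : V, ‖x‖ = ‖i |x|‖ := fun _ => rfl
  let S : NormedSpace ℝ V :=
    { norm_smul_le := fun c x => by
        rw [hN, hN, abs_smul_of_isOrderedModule, map_smul, norm_smul, Real.norm_eq_abs, abs_abs,
          Real.norm_eq_abs] }
  have hS : HasSolidNorm V := ⟨fun x y h => norm_map_abs_le hi h⟩
  have : CompleteSpace K := hK.completeSpace_coe
  have hle : ∀ x : V, ‖j x‖ ≤ ‖x‖ := fun x => norm_map_le_norm_map_abs hi x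
  let f : V →L[ℝ] K := LinearMap.mkContinuous j.toLinearMap 1 (fun x => by simpa using hle x)
  have hC : CompleteSpace V := by
    refine NormedAddCommGroup.completeSpace_of_summable_imp_tendsto fun u hu => ?_
    -- The new norm of `u n` is by definition the old norm of `j |u n|`, so the series of moduli
    -- also converges in `K`.
    have hsa : Summable fun n => j |u n| := Summable.of_norm hu
    have hsu : Summable fun n => j (u n) :=
      Summable.of_norm_bounded hu fun n => hle (u n)
    refine ⟨j.symm (∑' n, j (u n)), ?_⟩
    rw [tendsto_iff_norm_sub_tendsto_zero]
    have ht := tendsto_sum_nat_add fun n => j |u n|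
    refine squeeze_zero (fun _ => norm_nonneg _) (fun n => ?_)
      (tendsto_zero_iff_norm_tendsto_zero.1 ht)
    have hsum : j (∑ k ∈ Finset.range n, u k - j.symm (∑' n, j (u n))) =
        -∑' k, j (u (k + n)) := by
      rw [map_sub, map_sum, LinearEquiv.apply_symm_apply, ← hsu.sum_add_tsum_nat_add n]
      abel
    have hsa' := (summable_nat_add_iff n).2 hsa
    have hsu' := (summable_nat_add_iff n).2 hsu
    -- The error of the partial sum is minus the tail of the series, so its modulus is at most the
    -- tail of the moduli, which tends to zero in norm.
    have hbound : |∑ k ∈ Finset.range n, u k - j.symm (∑' n, j (u n))| ≤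
        j.symm (∑' k, j |u (k + n)|) := by
      refine abs_le'.2 ⟨?_, ?_⟩
      · rw [← hj, hsum, LinearEquiv.apply_symm_apply, ← tsum_neg]
        refine hsu'.neg.tsum_le_tsum (fun k => ?_) hsa'
        rw [← map_neg, hj]
        exact neg_le_abs _
      · rw [← hj, map_neg, hsum, LinearEquiv.apply_symm_apply, neg_neg]
        exact hsu'.tsum_le_tsum (fun k => (hj _ _).2 (le_abs_self _)) hsa'
    have hnorm := norm_map_abs_le hi hbound
    rw [← hN] at hnorm
    simpa [i] using hnorm
  -- Both norms are complete, so the continuous bijection `f` has a continuous inverse.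
  refine ⟨V, N, S, inferInstance, inferInstance, inferInstance, hS, hC,
    ContinuousLinearEquiv.ofBijective f (LinearMap.ker_eq_bot.2 j.injective)
      (LinearMap.range_eq_top.2 j.surjective), hj, fun _ => rfl⟩

theorem mainTheorem11 {E : Type u} [NormedAddCommGroup E] [NormedSpace ℝ E] [Lattice E]
    [IsOrderedAddMonoid E] [IsOrderedModule ℝ E] [HasSolidNorm E] [CompleteSpace E]
    (T : E →L[ℝ] E) (hT : UoDemiDunfordPettis T) (hK : IsRieszSpace (fixedSpace T)) :
    PositiveSchurProperty (fixedSpace T) ∧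
    ∃ (X : Type u) (_ : NormedAddCommGroup X) (_ : NormedSpace ℝ X) (_ : Lattice X)
      (_ : IsOrderedAddMonoid X) (_ : IsOrderedModule ℝ X) (_ : HasSolidNorm X)
      (_ : CompleteSpace X) (e : X ≃L[ℝ] fixedSpace T),
      (∀ x y : X, e x ≤ e y ↔ x ≤ y) ∧
      (IsRieszSubspace (fixedSpace T) → ∀ x : X, ‖e x‖ = ‖x‖) ∧
      PositiveSchurProperty X := by
  have hP : PositiveSchurProperty (fixedSpace T) := fun _ _ hx => hT.tendsto_norm_of_weaklyNull hx
  refine ⟨hP, ?_⟩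
  have hclosed : IsClosed (fixedSpace T : Set E) :=
    (ContinuousLinearMap.id ℝ E - T).isClosed_ker
  let L : Lattice (fixedSpace T) := hK.toLattice
  obtain ⟨X, _, _, _, _, _, _, _, e, he, hN⟩ := exists_banachLattice_norm (V := fixedSpace T)
    hclosed (LinearEquiv.refl ℝ _) (fun _ _ => Iff.rfl)
  refine ⟨X, inferInstance, inferInstance, inferInstance, inferInstance, inferInstance,
    inferInstance, inferInstance, e, he, fun hR x => ?_, hP.of_equiv e he⟩
  -- In a Riesz subspace the modulus taken in `E` already lies in `K`, so it is also the least upper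
  -- bound of `± e x` within `K`.
  have habs : (e |x| : E) = |(e x : E)| := by
    apply le_antisymm
    · obtain ⟨y, hy⟩ := e.surjective ⟨|(e x : E)|, (hR _ (e x).2 _ (neg_mem (e x).2)).1⟩
      have hy' : (e y : E) = |(e x : E)| := congrArg Subtype.val hy
      rw [← hy']
      refine (he _ _).2 (abs_le'.2 ⟨(he _ _).1 ?_, (he _ _).1 ?_⟩)
      · exact (le_abs_self (e x : E)).trans hy'.ge
      · rw [map_neg]
        exact (neg_le_abs (e x : E)).trans hy'.ge
    · refine abs_le'.2 ⟨(he _ _).2 (le_abs_self x), ?_⟩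
      have h := (he _ _).2 (neg_le_abs x)
      rw [map_neg] at h
      exact h
  rw [hN, habs, norm_abs_eq_norm, Submodule.coe_norm]
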